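/- Let $\mathcal H$ be a real Hilbert space (not necessarily separable), $\mathcal D$ a probability distribution on a measurable space $\Xi$, and $(T_\xi)_{\xi\in\Xi}$ a family of operators $T_\xi\colon\mathcal H\to\mathcal H$ such that - for $\mathcal D$-almost every $\xi$, $T_\xi$ is nonexpansive, i.e. $\|T_\xi x-T_\xi y\|\le\|x-y\|$ for all $x,y\in\mathcal H$; - for every $x\in\mathcal H$, the map $\xi\mapsto T_\xi x$ is (strongly) measurable and Bochner integrable with respect to $\mathcal D$. Define $T\colon\mathcal H\to\mathcal H$ by $Tx=\mathbb E_{\xi\sim\mathcal D}[T_\xi x]$ and $\operatorname{Fix}(T)=\{x\in\mathcal H: Tx=x\}$. Assume that $\operatorname{Fix}(T)$ is nonempty and that $\mathbb E_{\xi\sim\mathcal D}\big[\|T_\xi p-Tp\|^2\big]<+\infty$ for some $p\in\operatorname{Fix}(T)$. Let $(\lambda_k)_{k\ge0}\subset(0,1)$ satisfy $\sum_{k=0}^\infty\lambda_k^2<+\infty$ and $\sum_{k=0}^\infty\lambda_k=+\infty$. Let $\xi_0,\xi_1,\dots$ be independent random variables with distribution $\mathcal D$, defined on a common probability space, let $x_0\in\mathcal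 H$, and define the stochastic Krasnoselskii–Mann iterates by $$x_{k+1}=(1-\lambda_k)x_k+\lambda_kT_{\xi_k}(x_k),\qquad k\ge0.$$ Then, almost surely, 1. $\|Tx_k-x_k\|\to0$ as $k\to\infty$, and 2. $(x_k)$ converges weakly to a (possibly random) element of $\operatorname{Fix}(T)$. -/

import Mathlib

open MeasureTheory ProbabilityTheory Filter Topology

/-- The expected operator `T x = 𝔼_{ξ ∼ D}[T_ξ x]` (Bochner integral) of a family of operators
`S ξ = T_ξ : H → H` indexed by a sample space `Ξ` with distribution `D`. -/
noncomputable def expectedOperator {Ξ H : Type*} [MeasurableSpace Ξ]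
    [NormedAddCommGroup H] [InnerProductSpace ℝ H]
    (D : Measure Ξ) (S : Ξ → H → H) (x : H) : H :=
  ∫ ξ, S ξ x ∂D

/-- The iterates of the stochastic Krasnoselskii-Mann algorithm started at `x₀`, along a sequence
of samples `s 0, s 1, …`, with relaxation parameters `lam`:
`x_{k+1} = (1 - λ_k) x_k + λ_k T_{s k}(x_k)`. -/
def skmIterate {Ξ H : Type*} [NormedAddCommGroup H] [InnerProductSpace ℝ H]
    (S : Ξ → H → H) (lam : ℕ → ℝ) (x₀ : H) (s : ℕ → Ξ) : ℕ → H
  | 0 => x₀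
  | k + 1 => (1 - lam k) • skmIterate S lam x₀ s k
      + lam k • S (s k) (skmIterate S lam x₀ s k)

/-! Each iteration is a deterministic step `x + λ (T x - x)` plus a noise term, `λ` times a variable
with mean zero given the past. Averaging keeps `T` nonexpansive, and at any fixed point `q` a
bias-variance computation, with `σ` the variance at `q` and `r k = ‖T x_k - x_k‖`, shows that `‖x_k
- q‖² + σ` has next conditional expectation at most `(1 + 6 λ_k²)` times itself minus `λ_k r_k²`.
Robbins–Siegmund (`ae_tendsto_and_summable_of_condExp_le`) then gives almost surely the convergence
of `‖x_k - q‖` and `∑ λ_k r_k² < ∞`.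

Since `∑ λ_k = ∞`, this only makes `r` small infinitely often. For `r → 0`, the accumulated noise is
shown to be almost surely Cauchy by Doob's maximal inequality, its expected tails being controlled
by those of `∑ λ_k²`. As `r` changes by at most twice the displacement of the iterates, it cannot
climb back from a small value: the drift is paid for by `∑ λ_k r_k²`
(`tendsto_zero_of_summable_mul_sq`).

Demiclosedness makes every weak cluster point a fixed point, and Opial's argument leaves only one.
The null set on which `‖x_k - q‖` may fail to converge depends on `q`, and `H` need not be
separable. But strongly measurable iterates lie in one closed separable subspace, weak limits stay
there, and a countable dense set of its fixed points suffices. -/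

section Deterministic

/-! ### Weak limits, Opial's lemma and a criterion for vanishing residuals. -/

variable {H : Type*} [NormedAddCommGroup H] [InnerProductSpace ℝ H]

/-- Demiclosedness principle for nonexpansive maps along a filter. -/
theorem isFixedPt_of_tendsto_inner {ι : Type*} {l : Filter ι} [l.NeBot] {T : H → H}
    (hT : ∀ x y, ‖T x - T y‖ ≤ ‖x - y‖) {x : ι → H} {B : ℝ} (hB : ∀ i, ‖x i‖ ≤ B)
    (hr : Tendsto (fun i => ‖T (x i) - x i‖) l (𝓝 0)) {q : H}
    (hw : ∀ y, Tendsto (fun i => inner ℝ (x i) y) l (𝓝 (inner ℝ q y))) : T q = q := by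
  -- Compare the exact expansion of `‖x i - T q‖²` about `q` with the triangle bound through `T (x
  -- i)`: the terms `‖x i - q‖²` cancel, and what remains on the right tends to zero.
  have key : ∀ i, ‖q - T q‖ ^ 2 ≤ ‖T (x i) - x i‖ ^ 2 + 2 * ‖T (x i) - x i‖ * (B + ‖q‖)
      - 2 * (inner ℝ (x i) (q - T q) - inner ℝ q (q - T q)) := by
    intro i
    have h1 : ‖x i - T q‖ ^ 2 = ‖x i - q‖ ^ 2 + 2 * inner ℝ (x i - q) (q - T q)
        + ‖q - T q‖ ^ 2 := by
      rw [← norm_add_sq_real]; congr 2; abel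
    have h2 : ‖x i - T q‖ ≤ ‖T (x i) - x i‖ + ‖x i - q‖ := by
      calc ‖x i - T q‖ = ‖-(T (x i) - x i) + (T (x i) - T q)‖ := by congr 1; abel
        _ ≤ ‖T (x i) - x i‖ + ‖T (x i) - T q‖ := by
          simpa only [norm_neg] using norm_add_le (-(T (x i) - x i)) (T (x i) - T q)
        _ ≤ _ := by gcongr; exact hT _ _
    have h3 : ‖x i - q‖ ≤ B + ‖q‖ := (norm_sub_le _ _).trans (by gcongr; exact hB i)
    have h4 := pow_le_pow_left₀ (norm_nonneg _) h2 2
    have h5 := mul_le_mul_of_nonneg_left h3 (norm_nonneg (T (x i) - x i))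
    rw [inner_sub_left] at h1
    nlinarith
  have hlim : Tendsto (fun i => ‖T (x i) - x i‖ ^ 2 + 2 * ‖T (x i) - x i‖ * (B + ‖q‖)
      - 2 * (inner ℝ (x i) (q - T q) - inner ℝ q (q - T q))) l
      (𝓝 (0 ^ 2 + 2 * 0 * (B + ‖q‖) - 2 * (inner ℝ q (q - T q) - inner ℝ q (q - T q)))) :=
    ((hr.pow 2).add ((hr.const_mul 2).mul_const _)).sub
      (((hw _).sub_const _).const_mul 2)
  have h0 : ‖q - T q‖ ^ 2 ≤ 0 := by
    have := ge_of_tendsto' hlim key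
    simpa using this
  have : ‖q - T q‖ = 0 := by nlinarith [norm_nonneg (q - T q)]
  exact (sub_eq_zero.1 (norm_eq_zero.1 this)).symm

/-- A bounded family in a Hilbert space converges weakly along every ultrafilter. -/
theorem exists_tendsto_inner_ultrafilter [CompleteSpace H] {ι : Type*} (U : Ultrafilter ι)
    {x : ι → H} {B : ℝ} (hB : ∀ i, ‖x i‖ ≤ B) :
    ∃ q : H, ∀ y, Tendsto (fun i => inner ℝ (x i) y) U (𝓝 (inner ℝ q y)) := by
  -- Banach–Alaoglu, after identifying `H` with its dual by Riesz.
  let φ : ι → WeakDual ℝ H := fun i => StrongDual.toWeakDual (innerSL ℝ (x i))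
  have hmem : ∀ i, φ i ∈ WeakDual.toStrongDual ⁻¹' Metric.closedBall (0 : StrongDual ℝ H) B := by
    intro i
    simpa [φ] using hB i
  obtain ⟨f, -, hf⟩ := (WeakDual.isCompact_closedBall (0 : StrongDual ℝ H) B).ultrafilter_le_nhds
    (U.map φ) (by
      rw [le_principal_iff]
      exact Filter.mem_map.2 (Filter.univ_mem' hmem))
  refine ⟨(InnerProductSpace.toDual ℝ H).symm (WeakDual.toStrongDual f), fun y => ?_⟩
  have hft : Tendsto φ U (𝓝 f) := hf
  have := (WeakDual.eval_continuous y).continuousAt.tendsto.comp hft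
  rw [InnerProductSpace.toDual_symm_apply]
  exact this

/-- Opial's lemma for an asymptotically regular sequence of a nonexpansive map, in which Fejér
monotonicity is only required with respect to fixed points in a closed subspace containing the
sequence. -/
theorem exists_fixedPt_tendsto_toWeakSpace [CompleteSpace H] {T : H → H}
    (hT : ∀ x y, ‖T x - T y‖ ≤ ‖x - y‖) {x : ℕ → H} {B : ℝ} (hB : ∀ i, ‖x i‖ ≤ B)
    (hr : Tendsto (fun i => ‖T (x i) - x i‖) atTop (𝓝 0)) {V : Submodule ℝ H}
    (hV : IsClosed (V : Set H)) (hxV : ∀ i, x i ∈ V)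
    (hF : ∀ q ∈ V, T q = q → ∃ c, Tendsto (fun i => ‖x i - q‖) atTop (𝓝 c)) :
    ∃ q ∈ Function.fixedPoints T,
      Tendsto (fun k => toWeakSpace ℝ H (x k)) atTop (𝓝 (toWeakSpace ℝ H q)) := by
  have cluster : ∀ U : Ultrafilter ℕ, (U : Filter ℕ) ≤ atTop → ∃ q ∈ V, T q = q ∧
      ∀ y, Tendsto (fun i => inner ℝ (x i) y) U (𝓝 (inner ℝ q y)) := by
    intro U hU
    obtain ⟨q, hq⟩ := exists_tendsto_inner_ultrafilter U hB
    refine ⟨q, ?_, isFixedPt_of_tendsto_inner hT hB (hr.mono_left hU) hq, hq⟩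
    have : CompleteSpace V := hV.completeSpace_coe
    -- Closed subspaces are weakly closed: `V = Vᗮᗮ` is cut out by inner products, which pass to the
    -- weak limit.
    rw [← Submodule.orthogonal_orthogonal V, Submodule.mem_orthogonal']
    intro v hv
    refine tendsto_nhds_unique (hq v) ?_
    simp [fun i => Submodule.inner_right_of_mem_orthogonal (hxV i) hv]
  have uniq : ∀ U₁ U₂ : Ultrafilter ℕ, (U₁ : Filter ℕ) ≤ atTop → (U₂ : Filter ℕ) ≤ atTop →
      ∀ q₁ ∈ V, ∀ q₂ ∈ V, T q₁ = q₁ → T q₂ = q₂ →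
      (∀ y, Tendsto (fun i => inner ℝ (x i) y) U₁ (𝓝 (inner ℝ q₁ y))) →
      (∀ y, Tendsto (fun i => inner ℝ (x i) y) U₂ (𝓝 (inner ℝ q₂ y))) → q₁ = q₂ := by
    intro U₁ U₂ h₁ h₂ q₁ hq₁ q₂ hq₂ hf₁ hf₂ hw₁ hw₂
    obtain ⟨c₁, hc₁⟩ := hF q₁ hq₁ hf₁
    obtain ⟨c₂, hc₂⟩ := hF q₂ hq₂ hf₂
    -- Polarization writes this inner product through `‖x i - q₁‖²` and `‖x i - q₂‖²`, so it
    -- converges along the whole sequence and the two ultrafilter limits must agree.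
    have hlim : Tendsto (fun i => inner ℝ (x i) (q₁ - q₂)) atTop
        (𝓝 ((c₂ ^ 2 - c₁ ^ 2 + ‖q₁‖ ^ 2 - ‖q₂‖ ^ 2) / 2)) := by
      have := (((((hc₂.pow 2).sub (hc₁.pow 2)).add_const (‖q₁‖ ^ 2)).sub_const (‖q₂‖ ^ 2)).div_const 2)
      refine this.congr fun i => ?_
      rw [norm_sub_sq_real, norm_sub_sq_real, inner_sub_right]
      ring
    have e₁ := tendsto_nhds_unique (hw₁ (q₁ - q₂)) (hlim.mono_left h₁)
    have e₂ := tendsto_nhds_unique (hw₂ (q₁ - q₂)) (hlim.mono_left h₂)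
    have : inner ℝ (q₁ - q₂) (q₁ - q₂) = 0 := by
      rw [inner_sub_left, e₁, e₂, sub_self]
    exact sub_eq_zero.1 (inner_self_eq_zero.1 this)
  obtain ⟨q, hqV, hqT, hqw⟩ := cluster (Ultrafilter.of atTop) (Ultrafilter.of_le _)
  refine ⟨q, hqT, ?_⟩
  have hinner : ∀ y, Tendsto (fun i => inner ℝ (x i) y) atTop (𝓝 (inner ℝ q y)) := by
    intro y
    rw [tendsto_iff_ultrafilter]
    intro U hU
    obtain ⟨q', hqV', hqT', hqw'⟩ := cluster U hU
    obtain rfl := uniq _ _ (Ultrafilter.of_le _) hU q hqV q' hqV' hqT hqT' hqw hqw'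
    exact hqw' y
  have hinj : Function.Injective ((topDualPairing ℝ H).flip) := by
    intro a b hab
    refine ext_inner_left ℝ fun y => ?_
    have := LinearMap.congr_fun hab (innerSL ℝ y)
    simpa using this
  refine (WeakBilin.tendsto_iff_forall_eval_tendsto _ hinj).2 fun f => ?_
  have := hinner ((InnerProductSpace.toDual ℝ H).symm f)
  have h2 : ∀ z, inner ℝ z ((InnerProductSpace.toDual ℝ H).symm f) = f z := fun z => by
    rw [real_inner_comm, InnerProductSpace.toDual_symm_apply]
  simp only [h2] at this
  exact this

/-- If `∑ λ r² < ∞` and `∑ λ = ∞`, and if `r` varies by at most `2 ∑ λ r` up to the increments of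
a Cauchy sequence, then `r → 0`. -/
theorem tendsto_zero_of_summable_mul_sq {E : Type*} [NormedAddCommGroup E] {lam r : ℕ → ℝ}
    {M : ℕ → E}
    (hlam : ∀ k, 0 < lam k) (hlam0 : Tendsto lam atTop (𝓝 0)) (hlam_one : ¬ Summable lam)
    (hr0 : ∀ k, 0 ≤ r k) (hs : Summable (fun k => lam k * r k ^ 2)) (hM : CauchySeq M)
    (hinc : ∀ m n, m ≤ n → |r n - r m| ≤ 2 * ∑ k ∈ Finset.Ico m n, lam k * r k
      + 2 * ‖M n - M m‖) : Tendsto r atTop (𝓝 0) := by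
  have hMr : ∀ ε > 0, ∃ N, ∀ m ≥ N, ∀ n ≥ N, ‖M m - M n‖ < ε := by
    simpa only [dist_eq_norm] using Metric.cauchySeq_iff.1 hM
  have hsC : ∀ ε > 0, ∃ N, ∀ m ≥ N, ∀ n ≥ m, ∑ k ∈ Finset.Ico m n, lam k * r k ^ 2 < ε := by
    intro ε hε
    obtain ⟨N, hN⟩ := Metric.cauchySeq_iff.1 hs.hasSum.tendsto_sum_nat.cauchySeq ε hε
    refine ⟨N, fun m hm n hn => ?_⟩
    have := hN n (hm.trans hn) m hm
    rw [Real.dist_eq, ← Finset.sum_Ico_eq_sub _ hn] at this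
    exact (le_abs_self _).trans_lt this
  -- Otherwise `λ ≤ λ r² / ε²` eventually, making `λ` summable.
  have hfreq : ∀ ε > 0, ∀ N, ∃ m ≥ N, r m < ε := by
    intro ε hε N
    by_contra! hcon
    refine hlam_one ((summable_nat_add_iff N).1 ?_)
    refine Summable.of_nonneg_of_le (fun k => (hlam _).le) (fun k => ?_)
      (((summable_nat_add_iff N).2 hs).mul_right (1 / ε ^ 2))
    have h := hcon (k + N) (by omega)
    have h2 : ε ^ 2 ≤ r (k + N) ^ 2 := pow_le_pow_left₀ hε.le h 2
    rw [mul_one_div, le_div_iff₀ (by positivity)]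
    exact mul_le_mul_of_nonneg_left h2 (hlam _).le
  rw [Metric.tendsto_atTop]
  intro ε' hε'
  set ε := ε' / 2 with hεdef
  have hε : 0 < ε := by positivity
  obtain ⟨N₁, hN₁⟩ := hMr (ε / 8) (by positivity)
  obtain ⟨N₂, hN₂⟩ := hsC (ε ^ 2 / 8) (by positivity)
  obtain ⟨N₃, hN₃⟩ := (Metric.tendsto_atTop.1 hlam0) (1 / 8) (by positivity)
  obtain ⟨m, hm, hrm⟩ := hfreq ε hε (N₁ + N₂ + N₃)
  refine ⟨m, fun n hn => ?_⟩
  -- Start from the last time `j` at which `r < ε`. Afterwards `λ r ≤ λ r² / ε`, so the drift is a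
  -- small tail; index `j` itself is handled by `λ → 0`. Altogether `r n < ε + 2 (ε/8 + ε/8) + 2
  -- (ε/8) < 2 ε`.
  have hlast : ∃ j, m ≤ j ∧ j ≤ n ∧ r j < ε ∧ ∀ k, j < k → k ≤ n → ε ≤ r k := by
    induction n, hn using Nat.le_induction with
    | base => exact ⟨m, le_rfl, le_rfl, hrm, fun k h1 h2 => by omega⟩
    | succ n hn ih =>
      obtain ⟨j, h1, h2, h3, h4⟩ := ih
      by_cases h : r (n + 1) < ε
      · exact ⟨n + 1, by omega, le_rfl, h, fun k h1 h2 => by omega⟩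
      · refine ⟨j, h1, by omega, h3, fun k h5 h6 => ?_⟩
        rcases Nat.lt_or_ge k (n + 1) with h7 | h7
        · exact h4 k h5 (by omega)
        · obtain rfl : k = n + 1 := by omega
          exact not_lt.1 h
  obtain ⟨j, hmj, hjn, hrj, hk⟩ := hlast
  rw [Real.dist_eq, sub_zero, abs_of_nonneg (hr0 n)]
  rcases hjn.eq_or_lt with rfl | hlt
  · linarith
  have e1 := hinc j n hjn
  have e2 := hN₁ n (by omega) j (by omega)
  have e3 := hN₃ j (by omega)
  rw [Real.dist_eq, sub_zero, abs_of_pos (hlam j)] at e3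
  have e4 : ∑ k ∈ Finset.Ico (j + 1) n, lam k * r k
      ≤ (∑ k ∈ Finset.Ico (j + 1) n, lam k * r k ^ 2) * (1 / ε) := by
    rw [Finset.sum_mul]
    refine Finset.sum_le_sum fun k hkm => ?_
    rw [Finset.mem_Ico] at hkm
    have h := hk k (by omega) (by omega)
    rw [mul_one_div, le_div_iff₀ hε, mul_assoc]
    refine mul_le_mul_of_nonneg_left ?_ (hlam k).le
    nlinarith [hr0 k]
  have e5 := hN₂ (j + 1) (by omega) n hlt
  have e6 : (∑ k ∈ Finset.Ico (j + 1) n, lam k * r k ^ 2) * (1 / ε) ≤ ε / 8 := by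
    rw [mul_one_div, div_le_iff₀ hε]
    nlinarith
  have e7 : lam j * r j ≤ 1 / 8 * ε := by
    have := hr0 j
    have := hlam j
    gcongr
  rw [Finset.sum_eq_sum_Ico_succ_bot hlt] at e1
  have := le_abs_self (r n - r j)
  linarith

end Deterministic

/-! ### Joint measurability and conditioning on an independent variable. -/

section Freezing

/-- Joint measurability of a random nonexpansive operator evaluated at a strongly measurable
function of an independent variable. -/
theorem aestronglyMeasurable_prod_of_nonexpansive {α Ξ H : Type*} [MeasurableSpace α]
    [MeasurableSpace Ξ] [NormedAddCommGroup H] {μ : Measure α} [SFinite μ] {D : Measure Ξ}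
    [SFinite D] {S : Ξ → H → H} (hS : ∀ᵐ ξ ∂D, ∀ x y : H, ‖S ξ x - S ξ y‖ ≤ ‖x - y‖)
    (hSm : ∀ x, AEStronglyMeasurable (fun ξ => S ξ x) D) {g : α → H} (hg : StronglyMeasurable g) :
    AEStronglyMeasurable (fun z : α × Ξ => S z.2 (g z.1)) (μ.prod D) := by
  have hsnd := (Measure.quasiMeasurePreserving_snd (μ := μ) (ν := D))
  refine aestronglyMeasurable_of_tendsto_ae atTop
    (f := fun n z => S z.2 (hg.approx n z.1)) (fun n => ?_) ?_
  -- A simple function takes finitely many values `y`, so only measurability of each `S · y` is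
  -- needed; continuity of almost every `S ξ` then carries it to the limit.
  · have hsum : (fun z : α × Ξ => S z.2 (hg.approx n z.1)) = fun z =>
        ∑ y ∈ (hg.approx n).range,
          ((hg.approx n ⁻¹' {y}) ×ˢ Set.univ).indicator (fun z : α × Ξ => S z.2 y) z := by
      funext z
      rw [Finset.sum_eq_single (hg.approx n z.1)]
      · simp
      · intro y _ hy
        simp [hy.symm]
      · intro h
        exact absurd (SimpleFunc.mem_range_self _ _) h
    rw [hsum]
    refine Finset.aestronglyMeasurable_fun_sum _ fun y _ => ?_
    exact ((hSm y).comp_quasiMeasurePreserving hsnd).indicator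
      ((SimpleFunc.measurableSet_preimage _ _).prod MeasurableSet.univ)
  · filter_upwards [hsnd.ae hS] with z hz
    rw [tendsto_iff_norm_sub_tendsto_zero]
    refine squeeze_zero (fun n => norm_nonneg _) (fun n => hz _ _) ?_
    exact tendsto_iff_norm_sub_tendsto_zero.1 (hg.tendsto_approx z.1)

/-- Freezing lemma: the conditional expectation of `f (Y, X)` given `Y`, for independent `X`
and `Y`. -/
theorem condExp_comap_of_indepFun {Ω A Ξ : Type*} {mΩ : MeasurableSpace Ω} [mA : MeasurableSpace A]
    [MeasurableSpace Ξ] {P : Measure Ω} [IsProbabilityMeasure P] {Y : Ω → A} {X : Ω → Ξ}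
    (hY : Measurable Y) (hX : Measurable X) (hind : IndepFun Y X P) {f : A × Ξ → ℝ}
    (hf : AEStronglyMeasurable f ((P.map Y).prod (P.map X)))
    (hint : Integrable (fun ω => f (Y ω, X ω)) P) :
    P[fun ω => f (Y ω, X ω) | mA.comap Y] =ᵐ[P] fun ω => ∫ x, f (Y ω, x) ∂(P.map X) := by
  have : IsProbabilityMeasure (P.map Y) := Measure.isProbabilityMeasure_map hY.aemeasurable
  have : IsProbabilityMeasure (P.map X) := Measure.isProbabilityMeasure_map hX.aemeasurable
  have hmap : P.map (fun ω => (Y ω, X ω)) = (P.map Y).prod (P.map X) :=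
    (indepFun_iff_map_prod_eq_prod_map_map hY.aemeasurable hX.aemeasurable).1 hind
  have hYX : Measurable (fun ω => (Y ω, X ω)) := hY.prodMk hX
  have hfint : Integrable f ((P.map Y).prod (P.map X)) := by
    rw [← hmap] at hf ⊢
    exact (integrable_map_measure hf hYX.aemeasurable).2 hint
  have hgint : Integrable (fun a => ∫ x, f (a, x) ∂(P.map X)) (P.map Y) := hfint.integral_prod_left
  have hgint' : Integrable (fun ω => ∫ x, f (Y ω, x) ∂(P.map X)) P :=
    hgint.comp_measurable hY
  symm
  refine ae_eq_condExp_of_forall_setIntegral_eq hY.comap_le hint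
    (fun s _ _ => hgint'.integrableOn) ?_ ?_
  · rintro _ ⟨t, ht, rfl⟩ -
    calc ∫ ω in Y ⁻¹' t, ∫ x, f (Y ω, x) ∂(P.map X) ∂P
        = ∫ a in t, ∫ x, f (a, x) ∂(P.map X) ∂(P.map Y) :=
          (setIntegral_map ht hgint.aestronglyMeasurable hY.aemeasurable).symm
      _ = ∫ z in t ×ˢ Set.univ, f z ∂((P.map Y).prod (P.map X)) := by
          rw [setIntegral_prod _ hfint.integrableOn]
          simp
      _ = ∫ z in t ×ˢ Set.univ, f z ∂(P.map (fun ω => (Y ω, X ω))) := by rw [hmap]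
      _ = ∫ ω in Y ⁻¹' t, f (Y ω, X ω) ∂P := by
          rw [setIntegral_map (ht.prod MeasurableSet.univ) (by rwa [hmap]) hYX.aemeasurable]
          congr 2
          ext; simp
  · have hg := hgint.aestronglyMeasurable
    exact ⟨fun ω => hg.mk _ (Y ω), hg.stronglyMeasurable_mk.comp_measurable (comap_measurable Y),
      ae_of_ae_map hY.aemeasurable hg.ae_eq_mk⟩

/-- Freezing lemma for a sub-σ-algebra `m` independent of `X`. -/
theorem condExp_of_indep {Ω Ξ : Type*} {m mΩ : MeasurableSpace Ω} [mΞ : MeasurableSpace Ξ]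
    {P : Measure Ω} [IsProbabilityMeasure P] (hm : m ≤ mΩ) {X : Ω → Ξ} (hX : Measurable X)
    (hind : Indep m (mΞ.comap X) P) {f : Ω × Ξ → ℝ}
    (hf : AEStronglyMeasurable[m.prod mΞ] f (@Measure.prod Ω Ξ m mΞ (P.trim hm) (P.map X)))
    (hint : Integrable (fun ω => f (ω, X ω)) P) :
    P[fun ω => f (ω, X ω) | m] =ᵐ[P] fun ω => ∫ x, f (ω, x) ∂(P.map X) := by
  -- Conditioning on `m` is conditioning on the identity viewed as a variable with values in `(Ω,
  -- m)`, whose law is `P.trim hm`.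
  have hid : @Measurable Ω Ω mΩ m id := measurable_id'' hm
  have htrim : @Measure.map Ω Ω mΩ m id P = P.trim hm := (trim_eq_map hm).symm
  have := @condExp_comap_of_indepFun Ω Ω Ξ mΩ m mΞ P _ id X hid hX
    ((@IndepFun_iff_Indep Ω Ω Ξ mΩ m mΞ id X P).2
      (by rw [MeasurableSpace.comap_id]; exact hind)) f
    (by rw [htrim]; exact hf) hint
  rwa [MeasurableSpace.comap_id] at this

end Freezing

/-- The joint law of the identity, valued in `(Ω, m)`, and of a random variable independent
of `m`. -/
theorem map_prodMk_of_indep {Ω Ξ : Type*} {m mΩ : MeasurableSpace Ω} [mΞ : MeasurableSpace Ξ]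
    {P : Measure Ω} [IsProbabilityMeasure P] (hm : m ≤ mΩ) {X : Ω → Ξ} (hX : Measurable X)
    (hind : Indep m (mΞ.comap X) P) :
    @Measure.map Ω (Ω × Ξ) mΩ (m.prod mΞ) (fun ω => (ω, X ω)) P =
      @Measure.prod Ω Ξ m mΞ (P.trim hm) (P.map X) := by
  have hid : @Measurable Ω Ω mΩ m id := measurable_id'' hm
  have := (@indepFun_iff_map_prod_eq_prod_map_map Ω Ω Ξ mΩ P id X m mΞ _
    (@Measurable.aemeasurable Ω Ω mΩ m id P hid)
    hX.aemeasurable).1 ((@IndepFun_iff_Indep Ω Ω Ξ mΩ m mΞ id X P).2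
      (by rw [MeasurableSpace.comap_id]; exact hind))
  rw [trim_eq_map hm]
  exact this

theorem MeasureTheory.MemLp.of_sub {α E : Type*} [MeasurableSpace α] [NormedAddCommGroup E]
    {μ : Measure α} {q : ENNReal} {f g : α → E} (h : MemLp (fun a => f a - g a) q μ)
    (hg : MemLp g q μ) : MemLp f q μ := by
  have := h.add hg
  rwa [show (fun a => f a - g a) + g = f from funext fun a => sub_add_cancel _ _] at this

/-! ### The expected operator, its variance, and one random step. -/

section ExpectedOperator

variable {Ξ H : Type*} [MeasurableSpace Ξ] [NormedAddCommGroup H] [InnerProductSpace ℝ H]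
  {D : Measure Ξ} [IsProbabilityMeasure D] {S : Ξ → H → H}

theorem norm_expectedOperator_sub_le
    (hS : ∀ᵐ ξ ∂D, ∀ x y : H, ‖S ξ x - S ξ y‖ ≤ ‖x - y‖)
    (hS_int : ∀ x : H, Integrable (fun ξ => S ξ x) D) (x y : H) :
    ‖expectedOperator D S x - expectedOperator D S y‖ ≤ ‖x - y‖ := by
  unfold expectedOperator
  rw [← integral_sub (hS_int x) (hS_int y)]
  refine (norm_integral_le_of_norm_le_const (C := ‖x - y‖) ?_).trans (by simp)
  filter_upwards [hS] with ξ hξ using hξ x y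

theorem continuous_expectedOperator
    (hS : ∀ᵐ ξ ∂D, ∀ x y : H, ‖S ξ x - S ξ y‖ ≤ ‖x - y‖)
    (hS_int : ∀ x : H, Integrable (fun ξ => S ξ x) D) : Continuous (expectedOperator D S) :=
  (LipschitzWith.of_dist_le_mul (K := 1) fun x y => by
    simpa [dist_eq_norm] using norm_expectedOperator_sub_le hS hS_int x y).continuous

/-- The variance `𝔼‖T_ξ y - T y‖²` of a random operator at a point. -/
noncomputable def operatorVariance (D : Measure Ξ) (S : Ξ → H → H) (y : H) : ℝ :=
  ∫ ξ, ‖S ξ y - expectedOperator D S y‖ ^ 2 ∂D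

omit [IsProbabilityMeasure D] in
theorem operatorVariance_nonneg (y : H) : 0 ≤ operatorVariance D S y :=
  integral_nonneg fun _ => by positivity

theorem memLp_two_of_lintegral_lt_top (hS_int : ∀ x : H, Integrable (fun ξ => S ξ x) D) {p : H}
    (hVar : ∫⁻ ξ, ‖S ξ p - expectedOperator D S p‖ₑ ^ 2 ∂D < ⊤) :
    MemLp (fun ξ => S ξ p) 2 D := by
  have h : MemLp (fun ξ => S ξ p - expectedOperator D S p) 2 D := by
    refine ⟨(hS_int p).aestronglyMeasurable.sub aestronglyMeasurable_const, ?_⟩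
    rw [eLpNorm_lt_top_iff_lintegral_rpow_enorm_lt_top (by simp) (by simp)]
    simpa using hVar
  exact h.of_sub (memLp_const (expectedOperator D S p))

omit [InnerProductSpace ℝ H] in
theorem memLp_two_of_nonexpansive
    (hS : ∀ᵐ ξ ∂D, ∀ x y : H, ‖S ξ x - S ξ y‖ ≤ ‖x - y‖)
    (hS_int : ∀ x : H, Integrable (fun ξ => S ξ x) D) {p : H}
    (hp : MemLp (fun ξ => S ξ p) 2 D) (y : H) : MemLp (fun ξ => S ξ y) 2 D := by
  have h : MemLp (fun ξ => S ξ y - S ξ p) 2 D := by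
    refine (memLp_const (y - p)).of_le
      ((hS_int y).aestronglyMeasurable.sub (hS_int p).aestronglyMeasurable) ?_
    filter_upwards [hS] with ξ hξ using hξ y p
  exact h.of_sub hp

/-- The cross term vanishes because `S ξ y - T y` has mean zero. -/
theorem integral_norm_add_smul_sub_sq [CompleteSpace H] {y : H} (hy : MemLp (fun ξ => S ξ y) 2 D)
    (u : H) (c : ℝ) :
    ∫ ξ, ‖u + c • (S ξ y - expectedOperator D S y)‖ ^ 2 ∂D
      = ‖u‖ ^ 2 + c ^ 2 * operatorVariance D S y := by
  have hd : MemLp (fun ξ => S ξ y - expectedOperator D S y) 2 D := hy.sub (memLp_const _)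
  have hi := hd.integrable (by norm_num)
  have hsq := (memLp_two_iff_integrable_sq_norm hd.aestronglyMeasurable).1 hd
  have h0 : ∫ ξ, inner ℝ u (S ξ y - expectedOperator D S y) ∂D = 0 := by
    rw [integral_inner hi, integral_sub (hy.integrable (by norm_num)) (integrable_const _)]
    simp [expectedOperator]
  have hexp : ∀ ξ, ‖u + c • (S ξ y - expectedOperator D S y)‖ ^ 2 =
      ‖u‖ ^ 2 + 2 * c * inner ℝ u (S ξ y - expectedOperator D S y)
        + c ^ 2 * ‖S ξ y - expectedOperator D S y‖ ^ 2 := by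
    intro ξ
    rw [norm_add_sq_real, inner_smul_right, norm_smul, mul_pow, Real.norm_eq_abs, sq_abs]
    ring
  simp_rw [hexp]
  have hin : Integrable (fun ξ => inner ℝ u (S ξ y - expectedOperator D S y)) D :=
    hi.const_inner u
  rw [integral_add (f := fun ξ => ‖u‖ ^ 2 + 2 * c * inner ℝ u (S ξ y - expectedOperator D S y))
      ((integrable_const _).add (hin.const_mul _)) (hsq.const_mul _),
    integral_add (integrable_const _) (hin.const_mul _), integral_const_mul, integral_const_mul, h0]
  simp [operatorVariance]

/-- The variance is at most the second moment about any other point, here `p`; nonexpansiveness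
gives `‖S ξ y - p‖ ≤ ‖y - p‖ + ‖S ξ p - p‖`, and the factors 2 come from squaring this sum. Finite
variance at one fixed point thus controls it everywhere. -/
theorem operatorVariance_le [CompleteSpace H]
    (hS : ∀ᵐ ξ ∂D, ∀ x y : H, ‖S ξ x - S ξ y‖ ≤ ‖x - y‖)
    (hS_int : ∀ x : H, Integrable (fun ξ => S ξ x) D) {p : H}
    (hp : MemLp (fun ξ => S ξ p) 2 D) (hfix : expectedOperator D S p = p) (y : H) :
    operatorVariance D S y ≤ 2 * ‖y - p‖ ^ 2 + 2 * operatorVariance D S p := by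
  have hy := memLp_two_of_nonexpansive hS hS_int hp y
  have h1 := integral_norm_add_smul_sub_sq hy (expectedOperator D S y - p) 1
  have hdp : MemLp (fun ξ => S ξ p - p) 2 D := hp.sub (memLp_const _)
  have hdy : MemLp (fun ξ => S ξ y - p) 2 D := hy.sub (memLp_const _)
  have hsq := (memLp_two_iff_integrable_sq_norm hdp.aestronglyMeasurable).1 hdp
  have hsqy := (memLp_two_iff_integrable_sq_norm hdy.aestronglyMeasurable).1 hdy
  have h2 : ∫ ξ, ‖S ξ y - p‖ ^ 2 ∂D ≤ ∫ ξ, (2 * ‖y - p‖ ^ 2 + 2 * ‖S ξ p - p‖ ^ 2) ∂D := by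
    refine integral_mono_ae hsqy ((integrable_const _).add (hsq.const_mul _)) ?_
    filter_upwards [hS] with ξ hξ
    have h3 : ‖S ξ y - p‖ ≤ ‖y - p‖ + ‖S ξ p - p‖ := by
      calc ‖S ξ y - p‖ = ‖(S ξ y - S ξ p) + (S ξ p - p)‖ := by congr 1; abel
        _ ≤ _ := (norm_add_le _ _).trans (by gcongr; exact hξ y p)
    have := pow_le_pow_left₀ (norm_nonneg _) h3 2
    have := sq_nonneg (‖y - p‖ - ‖S ξ p - p‖)
    linarith
  rw [integral_add (integrable_const _) (hsq.const_mul 2)] at h2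
  have h4 : ∀ ξ, expectedOperator D S y - p + (1 : ℝ) • (S ξ y - expectedOperator D S y)
      = S ξ y - p := fun ξ => by rw [one_smul]; abel
  simp only [h4] at h1
  have h5 : operatorVariance D S p = ∫ ξ, ‖S ξ p - p‖ ^ 2 ∂D := by
    simp [operatorVariance, hfix]
  have := sq_nonneg ‖expectedOperator D S y - p‖
  simp only [integral_const_mul, integral_const, probReal_univ, one_smul] at h2
  rw [h5]
  linarith

variable {Ω : Type*} {m m' mΩ : MeasurableSpace Ω} {P : Measure Ω} [IsProbabilityMeasure P]

omit [InnerProductSpace ℝ H] in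
-- Independence makes the law of `(ω, X ω)` a product, so a jointly measurable version of `S x (g
-- ω)` may be evaluated along it. The second σ-algebra `m'` also sees `X`; it serves both as the
-- ambient one and as the next stage of a filtration.
theorem aestronglyMeasurable_apply_of_indep
    (hS : ∀ᵐ ξ ∂D, ∀ x y : H, ‖S ξ x - S ξ y‖ ≤ ‖x - y‖)
    (hS_int : ∀ x : H, Integrable (fun ξ => S ξ x) D) (hm : m ≤ mΩ) {X : Ω → Ξ}
    (hX : Measurable X) (hind : Indep m (MeasurableSpace.comap X inferInstance) P)
    (hlaw : P.map X = D) {g : Ω → H} (hg : StronglyMeasurable[m] g)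
    (hmm' : m ≤ m') (hX' : Measurable[m'] X) :
    AEStronglyMeasurable[m'] (fun ω => S (X ω) (g ω)) P := by
  subst hlaw
  have h := @aestronglyMeasurable_prod_of_nonexpansive Ω Ξ H m _ _ (P.trim hm) _ (P.map X) _ S hS
    (fun x => (hS_int x).aestronglyMeasurable) g hg
  rw [← map_prodMk_of_indep hm hX hind] at h
  obtain ⟨f, hf, hfe⟩ := h
  have hid : ∀ m₁ : MeasurableSpace Ω, m ≤ m₁ → Measurable[m₁] X →
      @Measurable Ω (Ω × Ξ) m₁ (m.prod inferInstance) (fun ω => (ω, X ω)) := fun m₁ h₁ hX₁ =>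
    @Measurable.prodMk Ω m₁ Ω Ξ m _ id X (measurable_id'' h₁) hX₁
  exact ⟨fun ω => f (ω, X ω), hf.comp_measurable (hid m' hmm' hX'),
    @ae_of_ae_map Ω (Ω × Ξ) mΩ (m.prod inferInstance) P _
      (@Measurable.aemeasurable Ω (Ω × Ξ) mΩ (m.prod inferInstance) _ P (hid mΩ hm hX)) _ hfe⟩

omit [InnerProductSpace ℝ H] in
theorem memLp_two_apply_of_indep
    (hS : ∀ᵐ ξ ∂D, ∀ x y : H, ‖S ξ x - S ξ y‖ ≤ ‖x - y‖)
    (hS_int : ∀ x : H, Integrable (fun ξ => S ξ x) D) {p : H} (hp : MemLp (fun ξ => S ξ p) 2 D)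
    (hm : m ≤ mΩ) {X : Ω → Ξ}
    (hX : Measurable X) (hind : Indep m (MeasurableSpace.comap X inferInstance) P)
    (hlaw : P.map X = D) {g : Ω → H} (hg : StronglyMeasurable[m] g) (hg2 : MemLp g 2 P) :
    MemLp (fun ω => S (X ω) (g ω)) 2 P := by
  have hmeas := aestronglyMeasurable_apply_of_indep hS hS_int hm hX hind hlaw hg hm hX
  subst hlaw
  have hpX : MemLp (fun ω => S (X ω) p) 2 P :=
    (memLp_map_measure_iff hp.aestronglyMeasurable hX.aemeasurable).1 hp
  have h : MemLp (fun ω => S (X ω) (g ω) - S (X ω) p) 2 P := by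
    refine (hg2.sub (memLp_const p)).of_le (hmeas.sub hpX.aestronglyMeasurable) ?_
    filter_upwards [ae_of_ae_map hX.aemeasurable hS] with ω hω using hω _ _
  exact h.of_sub hpX

/-- Bias-variance decomposition of the conditional second moment of one stochastic step. -/
theorem condExp_norm_add_smul_sub_sq [CompleteSpace H]
    (hS : ∀ᵐ ξ ∂D, ∀ x y : H, ‖S ξ x - S ξ y‖ ≤ ‖x - y‖)
    (hS_int : ∀ x : H, Integrable (fun ξ => S ξ x) D) {p : H} (hp : MemLp (fun ξ => S ξ p) 2 D)
    (hm : m ≤ mΩ) {X : Ω → Ξ}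
    (hX : Measurable X) (hind : Indep m (MeasurableSpace.comap X inferInstance) P)
    (hlaw : P.map X = D) {g Y : Ω → H} (hg : StronglyMeasurable[m] g) (hg2 : MemLp g 2 P)
    (hY : StronglyMeasurable[m] Y) (hY2 : MemLp Y 2 P) (c : ℝ) :
    P[fun ω => ‖Y ω + c • (S (X ω) (g ω) - expectedOperator D S (g ω))‖ ^ 2 | m] =ᵐ[P]
      fun ω => ‖Y ω‖ ^ 2 + c ^ 2 * operatorVariance D S (g ω) := by
  have hTc := continuous_expectedOperator hS hS_int
  have hTg : StronglyMeasurable[m] fun ω => expectedOperator D S (g ω) :=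
    hTc.comp_stronglyMeasurable hg
  have hSg := memLp_two_apply_of_indep hS hS_int hp hm hX hind hlaw hg hg2
  have hTg2 : MemLp (fun ω => expectedOperator D S (g ω)) 2 P := by
    have h : MemLp (fun ω => expectedOperator D S (g ω) - expectedOperator D S p) 2 P := by
      refine (hg2.sub (memLp_const p)).of_le
        ((hTg.mono hm).aestronglyMeasurable.sub aestronglyMeasurable_const) ?_
      exact ae_of_all _ fun ω => norm_expectedOperator_sub_le hS hS_int _ _
    exact h.of_sub (memLp_const (expectedOperator D S p))
  have hZ : MemLp (fun ω => Y ω + c • (S (X ω) (g ω) - expectedOperator D S (g ω))) 2 P :=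
    hY2.add ((hSg.sub hTg2).const_smul c)
  have hint := (memLp_two_iff_integrable_sq_norm hZ.aestronglyMeasurable).1 hZ
  have key : ∀ ω, ∫ ξ, ‖Y ω + c • (S ξ (g ω) - expectedOperator D S (g ω))‖ ^ 2 ∂D
      = ‖Y ω‖ ^ 2 + c ^ 2 * operatorVariance D S (g ω) := fun ω =>
    integral_norm_add_smul_sub_sq (memLp_two_of_nonexpansive hS hS_int hp _) _ _
  simp_rw [← key]
  have hmeas := @aestronglyMeasurable_prod_of_nonexpansive Ω Ξ H m _ _ (P.trim hm) _ D _ S hS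
    (fun x => (hS_int x).aestronglyMeasurable) g hg
  rw [← hlaw] at hmeas hTg ⊢
  refine condExp_of_indep hm hX hind
    (f := fun z => ‖Y z.1 + c • (S z.2 (g z.1) - expectedOperator (P.map X) S (g z.1))‖ ^ 2) ?_
    (by rw [hlaw]; exact hint)
  have hfst : ∀ {h : Ω → H}, StronglyMeasurable[m] h →
      AEStronglyMeasurable[m.prod inferInstance] (fun z : Ω × Ξ => h z.1)
        (@Measure.prod Ω Ξ m _ (P.trim hm) (P.map X)) := fun hh =>
    (hh.comp_measurable (@measurable_fst Ω Ξ m _)).aestronglyMeasurable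
  exact (((hfst hY).add ((hmeas.sub (hfst hTg)).const_smul c)).norm).pow 2

end ExpectedOperator

/-! ### Almost sure convergence from martingale theory. -/

section AlmostSure

variable {Ω : Type*} {mΩ : MeasurableSpace Ω} {P : Measure Ω}

/-- A Robbins–Siegmund theorem: if `V, W ≥ 0` satisfy
`𝔼[V (k + 1) | ℱ k] ≤ (1 + a k) V k - W k` with `∑ a k < ∞`, then almost surely `V` converges and
`∑ W k < ∞`; moreover the expectations of `V` are bounded. -/
theorem ae_tendsto_and_summable_of_condExp_le [IsFiniteMeasure P] {ℱ : Filtration ℕ mΩ}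
    {V W : ℕ → Ω → ℝ} {a : ℕ → ℝ} (ha0 : ∀ k, 0 ≤ a k) (ha : Summable a)
    (hV : StronglyAdapted ℱ V) (hW : StronglyAdapted ℱ W) (hV0 : ∀ k ω, 0 ≤ V k ω)
    (hW0 : ∀ k ω, 0 ≤ W k ω) (hVi : ∀ k, Integrable (V k) P) (hWi : ∀ k, Integrable (W k) P)
    (h : ∀ k, P[V (k + 1) | ℱ k] ≤ᵐ[P] fun ω => (1 + a k) * V k ω - W k ω) :
    (∀ᵐ ω ∂P, (∃ c, Tendsto (fun k => V k ω) atTop (𝓝 c)) ∧ Summable fun k => W k ω) ∧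
      ∃ C, ∀ k, ∫ ω, V k ω ∂P ≤ C := by
  set α : ℕ → ℝ := fun k => ∏ j ∈ Finset.range k, (1 + a j) with hα
  have hαs : ∀ k, α (k + 1) = α k * (1 + a k) := fun k => Finset.prod_range_succ _ _
  have hα1 : ∀ k, 1 ≤ α k := fun k => by
    induction k with
    | zero => simp [hα]
    | succ k ih => rw [hαs]; nlinarith [ha0 k]
  have hα0 : ∀ k, 0 < α k := fun k => one_pos.trans_le (hα1 k)
  have hαle : ∀ k, α k ≤ Real.exp (∑' j, a j) := fun k => by
    calc α k ≤ ∏ j ∈ Finset.range k, Real.exp (a j) :=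
          Finset.prod_le_prod (fun j _ => by linarith [ha0 j]) fun j _ => by
            linarith [Real.add_one_le_exp (a j)]
      _ = Real.exp (∑ j ∈ Finset.range k, a j) := (Real.exp_sum _ _).symm
      _ ≤ _ := Real.exp_le_exp.2 (ha.sum_le_tsum _ fun j _ => ha0 j)
  have hαmono : Monotone α := monotone_nat_of_le_succ fun k => by
    rw [hαs]; nlinarith [ha0 k, hα0 k]
  obtain ⟨L, hL⟩ : ∃ L, Tendsto α atTop (𝓝 L) :=
    ⟨_, tendsto_atTop_ciSup hαmono ⟨_, by rintro _ ⟨k, rfl⟩; exact hαle k⟩⟩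
  -- Dividing by the bounded products `α` removes the growth factors, and adding back the spent `W`
  -- yields a nonnegative supermartingale.
  set U : ℕ → Ω → ℝ := fun k ω =>
    (α k)⁻¹ * V k ω + ∑ j ∈ Finset.range k, (α (j + 1))⁻¹ * W j ω with hU
  have hSmeas : ∀ k n, k ≤ n + 1 → StronglyMeasurable[ℱ n]
      fun ω => ∑ j ∈ Finset.range k, (α (j + 1))⁻¹ * W j ω := fun k n hk =>
    Finset.stronglyMeasurable_fun_sum _ fun j hj =>
      ((hW j).mono (ℱ.mono (by have := Finset.mem_range.1 hj; omega))).const_mul _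
  have hSint : ∀ k, Integrable (fun ω => ∑ j ∈ Finset.range k, (α (j + 1))⁻¹ * W j ω) P :=
    fun k => integrable_finsetSum _ fun j _ => (hWi j).const_mul _
  have hUad : StronglyAdapted ℱ U := fun k =>
    ((hV k).const_mul _).add (hSmeas k k (by omega))
  have hUi : ∀ k, Integrable (U k) P := fun k => ((hVi k).const_mul _).add (hSint k)
  have hU0 : ∀ k ω, 0 ≤ U k ω := fun k ω => add_nonneg
    (mul_nonneg (inv_nonneg.2 (hα0 k).le) (hV0 k ω))
    (Finset.sum_nonneg fun j _ => mul_nonneg (inv_nonneg.2 (hα0 _).le) (hW0 j ω))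
  have hsuper : Supermartingale U ℱ P := by
    refine supermartingale_nat hUad hUi fun k => ?_
    have e1 : P[U (k + 1) | ℱ k] =ᵐ[P] fun ω => (α (k + 1))⁻¹ * (P[V (k + 1) | ℱ k]) ω
        + ∑ j ∈ Finset.range (k + 1), (α (j + 1))⁻¹ * W j ω := by
      have h1 := condExp_add (m := ℱ k) ((hVi (k + 1)).const_mul (α (k + 1))⁻¹) (hSint (k + 1))
      have h2 := condExp_smul (μ := P) (α (k + 1))⁻¹ (V (k + 1)) (ℱ k)
      have h3 := condExp_of_stronglyMeasurable (ℱ.le k) (hSmeas (k + 1) k le_rfl) (hSint (k + 1))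
      rw [h3] at h1
      filter_upwards [h1, h2] with ω h1 h2
      rw [Pi.smul_apply, smul_eq_mul] at h2
      rw [← h2]
      exact h1
    filter_upwards [e1, h k] with ω e1 e2
    rw [e1, Finset.sum_range_succ]
    have e3 : (α (k + 1))⁻¹ * (P[V (k + 1) | ℱ k]) ω
        ≤ (α k)⁻¹ * V k ω - (α (k + 1))⁻¹ * W k ω := by
      refine (mul_le_mul_of_nonneg_left e2 (inv_nonneg.2 (hα0 _).le)).trans_eq ?_
      have := (hα0 k).ne'
      have : 1 + a k ≠ 0 := by linarith [ha0 k]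
      rw [hαs]
      field_simp
    simp only [hU]
    linarith
  have hUle : ∀ k, ∫ ω, U k ω ∂P ≤ ∫ ω, U 0 ω ∂P := fun k => by
    simpa using hsuper.setIntegral_le (Nat.zero_le k) MeasurableSet.univ
  refine ⟨?_, L * ∫ ω, U 0 ω ∂P, fun k => ?_⟩
  · have hbdd : ∀ n, eLpNorm ((-U) n) 1 P ≤ ((∫ ω, U 0 ω ∂P).toNNReal : ENNReal) := by
      intro n
      rw [Pi.neg_apply, eLpNorm_neg, eLpNorm_one_eq_lintegral_enorm]
      calc ∫⁻ ω, ‖U n ω‖ₑ ∂P = ENNReal.ofReal (∫ ω, U n ω ∂P) := by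
            rw [ofReal_integral_eq_lintegral_ofReal (hUi n) (ae_of_all _ (hU0 n))]
            exact lintegral_congr fun ω => Real.enorm_of_nonneg (hU0 n ω)
        _ ≤ _ := ENNReal.ofReal_le_ofReal (hUle n)
    filter_upwards [hsuper.neg.exists_ae_tendsto_of_bdd hbdd] with ω ⟨c, hc⟩
    have hUt : Tendsto (fun k => U k ω) atTop (𝓝 (-c)) := by simpa using hc.neg
    obtain ⟨B, hB⟩ := hUt.bddAbove_range
    have hsum : Summable fun j => (α (j + 1))⁻¹ * W j ω := by
      refine summable_of_sum_range_le (c := B)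
        (fun j => mul_nonneg (inv_nonneg.2 (hα0 _).le) (hW0 j ω)) fun n => ?_
      refine le_trans ?_ (hB ⟨n, rfl⟩)
      exact le_add_of_nonneg_left (mul_nonneg (inv_nonneg.2 (hα0 _).le) (hV0 n ω))
    constructor
    · refine ⟨L * (-c - ∑' j, (α (j + 1))⁻¹ * W j ω), ?_⟩
      refine (hL.mul (hUt.sub hsum.hasSum.tendsto_sum_nat)).congr fun k => ?_
      simp only [hU]
      rw [add_sub_cancel_right, mul_inv_cancel_left₀ (hα0 k).ne']
    · refine Summable.of_nonneg_of_le (fun k => hW0 k ω) (fun k => ?_)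
        (hsum.mul_left (Real.exp (∑' j, a j)))
      rw [← mul_assoc, ← div_eq_mul_inv]
      exact le_mul_of_one_le_left (hW0 k ω) ((one_le_div (hα0 _)).2 (hαle _))
  · have h1 : (α k)⁻¹ * ∫ ω, V k ω ∂P ≤ ∫ ω, U 0 ω ∂P := by
      rw [← integral_const_mul]
      refine (integral_mono ((hVi k).const_mul _) (hUi k) fun ω => ?_).trans (hUle k)
      exact le_add_of_nonneg_right
        (Finset.sum_nonneg fun j _ => mul_nonneg (inv_nonneg.2 (hα0 _).le) (hW0 j ω))
    have h2 : 0 ≤ ∫ ω, U 0 ω ∂P := integral_nonneg (hU0 0)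
    rw [inv_mul_le_iff₀ (hα0 k)] at h1
    exact h1.trans (mul_le_mul_of_nonneg_right (hαmono.ge_of_tendsto hL k) h2)

/-- A process whose squared increments from each time `N` on form a submartingale with
expectations bounded by `τ N → 0` is almost surely Cauchy. -/
theorem ae_cauchySeq_of_submartingale_norm_sq {E : Type*} [NormedAddCommGroup E]
    [IsFiniteMeasure P] {M : ℕ → Ω → E} {𝒢 : ℕ → Filtration ℕ mΩ} {τ : ℕ → ℝ}
    (hsub : ∀ N, Submartingale (fun i ω => ‖M (N + i) ω - M N ω‖ ^ 2) (𝒢 N) P)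
    (hle : ∀ N i, ∫ ω, ‖M (N + i) ω - M N ω‖ ^ 2 ∂P ≤ τ N) (hτ : Tendsto τ atTop (𝓝 0)) :
    ∀ᵐ ω ∂P, CauchySeq fun n => M n ω := by
  -- Doob bounds the probability of failure at `N` by `τ N / δ`; failure at every `N` therefore has
  -- probability zero.
  have key : ∀ δ : NNReal, 0 < δ → ∀ᵐ ω ∂P, ∃ N, ∀ i, ‖M (N + i) ω - M N ω‖ ^ 2 < δ := by
    intro δ hδ
    have hbound : ∀ N, P {ω | ∃ i, (δ : ℝ) ≤ ‖M (N + i) ω - M N ω‖ ^ 2}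
        ≤ ENNReal.ofReal (τ N) / δ := by
      intro N
      set A : ℕ → Set Ω := fun n => {ω | (δ : ℝ) ≤ (Finset.range (n + 1)).sup'
        Finset.nonempty_range_add_one fun i => ‖M (N + i) ω - M N ω‖ ^ 2} with hA
      have hAmono : Monotone A := by
        intro n n' hn ω hω
        exact le_trans (show (δ : ℝ) ≤ _ from hω) (Finset.sup'_mono _ (by simpa using hn) _)
      have hset : {ω | ∃ i, (δ : ℝ) ≤ ‖M (N + i) ω - M N ω‖ ^ 2} = ⋃ n, A n := by
        ext ω
        simp only [hA, Set.mem_ofPred_eq, Set.mem_iUnion, Finset.le_sup'_iff, Finset.mem_range]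
        exact ⟨fun ⟨i, hi⟩ => ⟨i, i, by omega, hi⟩, fun ⟨_, i, _, hi⟩ => ⟨i, hi⟩⟩
      rw [hset, hAmono.measure_iUnion]
      refine iSup_le fun n => ?_
      rw [ENNReal.le_div_iff_mul_le (by simp [hδ.ne']) (by simp), mul_comm]
      refine (maximal_ineq (hsub N) (fun i ω => by positivity) n).trans
        (ENNReal.ofReal_le_ofReal ?_)
      exact (setIntegral_le_integral ((hsub N).integrable n)
        (ae_of_all _ fun ω => by positivity)).trans (hle N n)
    have hzero : P (⋂ N, {ω | ∃ i, (δ : ℝ) ≤ ‖M (N + i) ω - M N ω‖ ^ 2}) = 0 := by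
      refine le_antisymm ?_ zero_le
      have hlim : Tendsto (fun N => ENNReal.ofReal (τ N) / δ) atTop (𝓝 0) := by
        have := ENNReal.Tendsto.div_const (b := (δ : ENNReal)) (ENNReal.tendsto_ofReal hτ)
          (Or.inr (by simp [hδ.ne']))
        simpa using this
      exact ge_of_tendsto' hlim fun N => (measure_mono (Set.iInter_subset _ N)).trans (hbound N)
    rw [ae_iff]
    convert hzero using 2
    ext ω
    simp
  have hall : ∀ᵐ ω ∂P, ∀ j : ℕ, ∃ N, ∀ i,
      ‖M (N + i) ω - M N ω‖ ^ 2 < (((1 / ((j : NNReal) + 1)) ^ 2 : NNReal) : ℝ) :=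
    ae_all_iff.2 fun j => key _ (by positivity)
  filter_upwards [hall] with ω hω
  refine Metric.cauchySeq_iff'.2 fun ε hε => ?_
  obtain ⟨j, hj⟩ := exists_nat_one_div_lt hε
  obtain ⟨N, hN⟩ := hω j
  refine ⟨N, fun n hn => ?_⟩
  obtain ⟨i, rfl⟩ := Nat.exists_eq_add_of_le hn
  rw [dist_eq_norm]
  have := hN i
  push_cast at this
  exact (lt_of_pow_lt_pow_left₀ 2 (by positivity) this).trans hj

end AlmostSure

/-! ### The stochastic Krasnoselskii–Mann process. -/

section Iteration

/-- `g` is an adapted version of the stochastic Krasnoselskii–Mann iteration, driven by samples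
`X k` of law `D` that are independent of the past `ℱ k`. -/
structure IsSKMProcess {Ξ H Ω : Type*} [mΞ : MeasurableSpace Ξ] [NormedAddCommGroup H]
    [InnerProductSpace ℝ H] {mΩ : MeasurableSpace Ω} (D : Measure Ξ) (S : Ξ → H → H)
    (lam : ℕ → ℝ) (P : Measure Ω) (ℱ : Filtration ℕ mΩ) (X : ℕ → Ω → Ξ) (g : ℕ → Ω → H) :
    Prop where
  measurable : ∀ k, Measurable (X k)
  indep : ∀ k, Indep (ℱ k) (mΞ.comap (X k)) P
  law : ∀ k, P.map (X k) = D
  adapted : StronglyAdapted ℱ g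
  memLp_zero : MemLp (g 0) 2 P
  step : ∀ k, ∀ᵐ ω ∂P, g (k + 1) ω = (1 - lam k) • g k ω + lam k • S (X k ω) (g k ω)

/-- The deviation of a step from the deterministic Krasnoselskii–Mann step for the expected
operator. -/
noncomputable def skmNoise {Ξ H Ω : Type*} [MeasurableSpace Ξ] [NormedAddCommGroup H]
    [InnerProductSpace ℝ H] (D : Measure Ξ) (S : Ξ → H → H) (lam : ℕ → ℝ) (g : ℕ → Ω → H)
    (k : ℕ) (ω : Ω) : H :=
  g (k + 1) ω - g k ω - lam k • (expectedOperator D S (g k ω) - g k ω)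

/-- One deterministic Krasnoselskii–Mann step decreases the distance to a fixed point. -/
theorem norm_sub_add_smul_sq_le {H : Type*} [NormedAddCommGroup H] [InnerProductSpace ℝ H]
    {T : H → H} (hT : ∀ x y, ‖T x - T y‖ ≤ ‖x - y‖) {p : H} (hp : T p = p) {c : ℝ} (hc : 0 ≤ c)
    (y : H) : ‖y - p + c • (T y - y)‖ ^ 2 ≤
      (1 + 4 * c ^ 2) * ‖y - p‖ ^ 2 - c * ‖T y - y‖ ^ 2 := by
  have h1 : ‖T y - p‖ ≤ ‖y - p‖ := by simpa [hp] using hT y p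
  have h2 : ‖T y - p‖ ^ 2 = ‖y - p‖ ^ 2 + 2 * inner ℝ (y - p) (T y - y) + ‖T y - y‖ ^ 2 := by
    rw [← norm_add_sq_real]; congr 2; abel
  have h3 := pow_le_pow_left₀ (norm_nonneg _) h1 2
  -- This turns the quadratic term `c² ‖T y - y‖²` into `4 c² ‖y - p‖²`, so no upper bound on `c` is
  -- required.
  have h4 : ‖T y - y‖ ≤ 2 * ‖y - p‖ := by
    calc ‖T y - y‖ = ‖(T y - p) - (y - p)‖ := by congr 1; abel
      _ ≤ ‖T y - p‖ + ‖y - p‖ := norm_sub_le _ _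
      _ ≤ _ := by linarith
  have h5 := pow_le_pow_left₀ (norm_nonneg _) h4 2
  rw [norm_add_sq_real, inner_smul_right, norm_smul, mul_pow, Real.norm_eq_abs, sq_abs]
  have h6 := mul_le_mul_of_nonneg_left h5 (sq_nonneg c)
  have h7 : c * (2 * inner ℝ (y - p) (T y - y)) ≤ c * (-‖T y - y‖ ^ 2) :=
    mul_le_mul_of_nonneg_left (by linarith) hc
  linarith

variable {Ξ H Ω : Type*} [MeasurableSpace Ξ] [NormedAddCommGroup H] [InnerProductSpace ℝ H]
  {mΩ : MeasurableSpace Ω} {D : Measure Ξ} [IsProbabilityMeasure D] {S : Ξ → H → H}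
  {lam : ℕ → ℝ} {P : Measure Ω} [IsProbabilityMeasure P] {ℱ : Filtration ℕ mΩ} {X : ℕ → Ω → Ξ}
  {g : ℕ → Ω → H} {p : H}

namespace IsSKMProcess

theorem memLp (h : IsSKMProcess D S lam P ℱ X g)
    (hS : ∀ᵐ ξ ∂D, ∀ x y : H, ‖S ξ x - S ξ y‖ ≤ ‖x - y‖)
    (hS_int : ∀ x : H, Integrable (fun ξ => S ξ x) D) (hp : MemLp (fun ξ => S ξ p) 2 D) (k : ℕ) :
    MemLp (g k) 2 P := by
  induction k with
  | zero => exact h.memLp_zero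
  | succ k ih =>
    have hSg := memLp_two_apply_of_indep hS hS_int hp (ℱ.le k) (h.measurable k) (h.indep k)
      (h.law k) (h.adapted k) ih
    refine ((ih.const_smul (1 - lam k)).add (hSg.const_smul (lam k))).ae_eq ?_
    filter_upwards [h.step k] with ω hω
    exact hω.symm

omit [IsProbabilityMeasure P] in
theorem stronglyMeasurable_expectedOperator_comp (h : IsSKMProcess D S lam P ℱ X g)
    (hS : ∀ᵐ ξ ∂D, ∀ x y : H, ‖S ξ x - S ξ y‖ ≤ ‖x - y‖)
    (hS_int : ∀ x : H, Integrable (fun ξ => S ξ x) D) (k : ℕ) :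
    StronglyMeasurable[ℱ k] fun ω => expectedOperator D S (g k ω) :=
  (continuous_expectedOperator hS hS_int).comp_stronglyMeasurable (h.adapted k)

omit [IsProbabilityMeasure P] in
theorem stronglyMeasurable_noise (h : IsSKMProcess D S lam P ℱ X g)
    (hS : ∀ᵐ ξ ∂D, ∀ x y : H, ‖S ξ x - S ξ y‖ ≤ ‖x - y‖)
    (hS_int : ∀ x : H, Integrable (fun ξ => S ξ x) D) (k : ℕ) :
    StronglyMeasurable[ℱ (k + 1)] (skmNoise D S lam g k) :=
  ((h.adapted (k + 1)).sub ((h.adapted k).mono (ℱ.mono k.le_succ))).sub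
    ((((h.stronglyMeasurable_expectedOperator_comp hS hS_int k).sub (h.adapted k)).mono
      (ℱ.mono k.le_succ)).const_smul (lam k))

theorem memLp_residual (h : IsSKMProcess D S lam P ℱ X g)
    (hS : ∀ᵐ ξ ∂D, ∀ x y : H, ‖S ξ x - S ξ y‖ ≤ ‖x - y‖)
    (hS_int : ∀ x : H, Integrable (fun ξ => S ξ x) D) (hp : MemLp (fun ξ => S ξ p) 2 D) (k : ℕ) :
    MemLp (fun ω => expectedOperator D S (g k ω) - g k ω) 2 P := by
  have hg := h.memLp hS hS_int hp k
  have hT := (h.stronglyMeasurable_expectedOperator_comp hS hS_int k).mono (ℱ.le k)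
  refine MemLp.sub (MemLp.of_sub (g := fun _ => expectedOperator D S p) ?_ (memLp_const _)) hg
  exact (hg.sub (memLp_const p)).of_le (hT.aestronglyMeasurable.sub aestronglyMeasurable_const)
    (ae_of_all _ fun ω => norm_expectedOperator_sub_le hS hS_int _ _)

theorem memLp_noise (h : IsSKMProcess D S lam P ℱ X g)
    (hS : ∀ᵐ ξ ∂D, ∀ x y : H, ‖S ξ x - S ξ y‖ ≤ ‖x - y‖)
    (hS_int : ∀ x : H, Integrable (fun ξ => S ξ x) D) (hp : MemLp (fun ξ => S ξ p) 2 D) (k : ℕ) :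
    MemLp (skmNoise D S lam g k) 2 P :=
  ((h.memLp hS hS_int hp (k + 1)).sub (h.memLp hS hS_int hp k)).sub
    ((h.memLp_residual hS hS_int hp k).const_smul (lam k))

theorem condExp_norm_add_noise_sq [CompleteSpace H] (h : IsSKMProcess D S lam P ℱ X g)
    (hS : ∀ᵐ ξ ∂D, ∀ x y : H, ‖S ξ x - S ξ y‖ ≤ ‖x - y‖)
    (hS_int : ∀ x : H, Integrable (fun ξ => S ξ x) D) (hp : MemLp (fun ξ => S ξ p) 2 D) (k : ℕ)
    {Y : Ω → H} (hY : StronglyMeasurable[ℱ k] Y) (hY2 : MemLp Y 2 P) :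
    P[fun ω => ‖Y ω + skmNoise D S lam g k ω‖ ^ 2 | ℱ k] =ᵐ[P]
      fun ω => ‖Y ω‖ ^ 2 + lam k ^ 2 * operatorVariance D S (g k ω) := by
  refine (condExp_congr_ae ?_).trans (condExp_norm_add_smul_sub_sq hS hS_int hp (ℱ.le k)
    (h.measurable k) (h.indep k) (h.law k) (h.adapted k) (h.memLp hS hS_int hp k) hY hY2 (lam k))
  filter_upwards [h.step k] with ω hω
  have : skmNoise D S lam g k ω =
      lam k • (S (X k ω) (g k ω) - expectedOperator D S (g k ω)) := by
    rw [skmNoise, hω]; module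
  rw [this]

theorem integrable_norm_sub_sq (h : IsSKMProcess D S lam P ℱ X g)
    (hS : ∀ᵐ ξ ∂D, ∀ x y : H, ‖S ξ x - S ξ y‖ ≤ ‖x - y‖)
    (hS_int : ∀ x : H, Integrable (fun ξ => S ξ x) D) (hp : MemLp (fun ξ => S ξ p) 2 D) (k : ℕ) :
    Integrable (fun ω => ‖g k ω - p‖ ^ 2) P :=
  ((h.memLp hS hS_int hp k).sub (memLp_const p)).integrable_norm_pow (p := 2) (by norm_num)

/-- Quasi-Fejér monotonicity with respect to a fixed point: the distances to it converge, and the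
squared residuals are summable with weights `lam`. -/
theorem ae_tendsto_and_summable [CompleteSpace H] (h : IsSKMProcess D S lam P ℱ X g)
    (hS : ∀ᵐ ξ ∂D, ∀ x y : H, ‖S ξ x - S ξ y‖ ≤ ‖x - y‖)
    (hS_int : ∀ x : H, Integrable (fun ξ => S ξ x) D) (hp : MemLp (fun ξ => S ξ p) 2 D)
    (hfix : expectedOperator D S p = p) (hlam : ∀ k, 0 ≤ lam k)
    (hlam_sq : Summable (fun k => lam k ^ 2)) :
    (∀ᵐ ω ∂P, (∃ c, Tendsto (fun k => ‖g k ω - p‖) atTop (𝓝 c)) ∧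
      Summable fun k => lam k * ‖expectedOperator D S (g k ω) - g k ω‖ ^ 2) ∧
      ∃ C, ∀ k, ∫ ω, ‖g k ω - p‖ ^ 2 ∂P ≤ C := by
  set σ := operatorVariance D S p with hσ
  have hσ0 : 0 ≤ σ := operatorVariance_nonneg p
  have hsq := h.integrable_norm_sub_sq hS hS_int hp
  have hW : ∀ k, StronglyMeasurable[ℱ k] fun ω => expectedOperator D S (g k ω) - g k ω :=
    fun k => (h.stronglyMeasurable_expectedOperator_comp hS hS_int k).sub (h.adapted k)
  -- The 6 is 4 from the deterministic step plus 2 from the variance bound. Adding `σ` to the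
  -- squared distance absorbs the additive error `2 λ² σ` into the multiplicative factor.
  have hcond : ∀ k, P[fun ω => ‖g (k + 1) ω - p‖ ^ 2 + σ | ℱ k] ≤ᵐ[P] fun ω =>
      (1 + 6 * lam k ^ 2) * (‖g k ω - p‖ ^ 2 + σ)
        - lam k * ‖expectedOperator D S (g k ω) - g k ω‖ ^ 2 := by
    intro k
    have hY : StronglyMeasurable[ℱ k]
        fun ω => g k ω - p + lam k • (expectedOperator D S (g k ω) - g k ω) :=
      ((h.adapted k).sub stronglyMeasurable_const).add ((hW k).const_smul (lam k))
    have hY2 : MemLp (fun ω => g k ω - p + lam k • (expectedOperator D S (g k ω) - g k ω)) 2 P :=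
      ((h.memLp hS hS_int hp k).sub (memLp_const p)).add
        ((h.memLp_residual hS hS_int hp k).const_smul (lam k))
    have e1 := h.condExp_norm_add_noise_sq hS hS_int hp k hY hY2
    have e2 : (fun ω => ‖g k ω - p + lam k • (expectedOperator D S (g k ω) - g k ω)
        + skmNoise D S lam g k ω‖ ^ 2) = fun ω => ‖g (k + 1) ω - p‖ ^ 2 := by
      funext ω
      congr 2
      rw [skmNoise]
      abel
    rw [e2] at e1
    have e3 := condExp_add (m := ℱ k) (hsq (k + 1)) (integrable_const (μ := P) σ)
    rw [condExp_const (ℱ.le k)] at e3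
    filter_upwards [e1, e3] with ω e1 e3
    refine (e3.trans (congrArg (· + σ) e1)).trans_le ?_
    have e4 := norm_sub_add_smul_sq_le (norm_expectedOperator_sub_le hS hS_int) hfix (hlam k)
      (g k ω)
    have e5 := mul_le_mul_of_nonneg_left (operatorVariance_le hS hS_int hp hfix (g k ω))
      (sq_nonneg (lam k))
    have e6 := mul_nonneg (sq_nonneg (lam k)) hσ0
    linarith
  obtain ⟨h1, C, hC⟩ := ae_tendsto_and_summable_of_condExp_le (P := P) (ℱ := ℱ)
    (V := fun k ω => ‖g k ω - p‖ ^ 2 + σ)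
    (W := fun k ω => lam k * ‖expectedOperator D S (g k ω) - g k ω‖ ^ 2)
    (a := fun k => 6 * lam k ^ 2) (fun k => by positivity) (hlam_sq.mul_left 6)
    (fun k => ((((h.adapted k).sub stronglyMeasurable_const).norm).pow 2).add
      stronglyMeasurable_const)
    (fun k => ((hW k).norm.pow 2).const_mul (lam k))
    (fun k ω => by positivity) (fun k ω => mul_nonneg (hlam k) (by positivity))
    (fun k => (hsq k).add (integrable_const σ))
    (fun k => ((h.memLp_residual hS hS_int hp k).integrable_norm_pow (p := 2)
      (by norm_num)).const_mul (lam k)) hcond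
  refine ⟨?_, C, fun k => ?_⟩
  · filter_upwards [h1] with ω ⟨⟨c, hc⟩, hs⟩
    refine ⟨⟨√(c - σ), ?_⟩, hs⟩
    refine ((Real.continuous_sqrt.tendsto _).comp (hc.sub_const σ)).congr fun k => ?_
    simp [Real.sqrt_sq]
  · refine le_trans ?_ (hC k)
    exact integral_mono (hsq k) ((hsq k).add (integrable_const σ)) fun ω => by
      simpa using hσ0

/-- The accumulated noise converges almost surely. -/
theorem ae_cauchySeq_sum_noise [CompleteSpace H] (h : IsSKMProcess D S lam P ℱ X g)
    (hS : ∀ᵐ ξ ∂D, ∀ x y : H, ‖S ξ x - S ξ y‖ ≤ ‖x - y‖)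
    (hS_int : ∀ x : H, Integrable (fun ξ => S ξ x) D) (hp : MemLp (fun ξ => S ξ p) 2 D)
    (hfix : expectedOperator D S p = p) (hlam : ∀ k, 0 ≤ lam k)
    (hlam_sq : Summable (fun k => lam k ^ 2)) :
    ∀ᵐ ω ∂P, CauchySeq fun n => ∑ j ∈ Finset.range n, skmNoise D S lam g j ω := by
  obtain ⟨-, C, hC⟩ := h.ae_tendsto_and_summable hS hS_int hp hfix hlam hlam_sq
  set σ := operatorVariance D S p with hσ
  have hsq := h.integrable_norm_sub_sq hS hS_int hp
  have hdiff : ∀ N i, (fun ω => ∑ j ∈ Finset.range (N + i), skmNoise D S lam g j ω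
      - ∑ j ∈ Finset.range N, skmNoise D S lam g j ω) =
      fun ω => ∑ j ∈ Finset.range i, skmNoise D S lam g (N + j) ω := fun N i => by
    funext ω; rw [Finset.sum_range_add, add_sub_cancel_left]
  have hmeas : ∀ N i, StronglyMeasurable[ℱ (N + i)]
      fun ω => ∑ j ∈ Finset.range i, skmNoise D S lam g (N + j) ω := fun N i =>
    Finset.stronglyMeasurable_fun_sum _ fun j hj =>
      (h.stronglyMeasurable_noise hS hS_int (N + j)).mono
        (ℱ.mono (by have := Finset.mem_range.1 hj; omega))
  have hLp : ∀ N i, MemLp (fun ω => ∑ j ∈ Finset.range i, skmNoise D S lam g (N + j) ω) 2 P :=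
    fun N i => memLp_finsetSum _ fun j _ => h.memLp_noise hS hS_int hp (N + j)
  have hint : ∀ N i, Integrable
      (fun ω => ‖∑ j ∈ Finset.range i, skmNoise D S lam g (N + j) ω‖ ^ 2) P := fun N i =>
    (hLp N i).integrable_norm_pow (p := 2) (by norm_num)
  have hcond : ∀ N i, P[fun ω => ‖∑ j ∈ Finset.range (i + 1), skmNoise D S lam g (N + j) ω‖ ^ 2
      | ℱ (N + i)] =ᵐ[P] fun ω => ‖∑ j ∈ Finset.range i, skmNoise D S lam g (N + j) ω‖ ^ 2
        + lam (N + i) ^ 2 * operatorVariance D S (g (N + i) ω) := fun N i => by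
    simp_rw [Finset.sum_range_succ]
    exact h.condExp_norm_add_noise_sq hS hS_int hp (N + i) (hmeas N i) (hLp N i)
  let 𝒢 : ℕ → Filtration ℕ mΩ := fun N =>
    ⟨fun i => ℱ (N + i), fun i j hij => ℱ.mono (by omega), fun i => ℱ.le _⟩
  refine ae_cauchySeq_of_submartingale_norm_sq (𝒢 := 𝒢)
    (τ := fun N => (2 * C + 2 * σ) * ∑' j, lam (j + N) ^ 2) (fun N => ?_) (fun N i => ?_) ?_
  · have hfun : (fun i ω => ‖∑ j ∈ Finset.range (N + i), skmNoise D S lam g j ω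
        - ∑ j ∈ Finset.range N, skmNoise D S lam g j ω‖ ^ 2) =
        fun i ω => ‖∑ j ∈ Finset.range i, skmNoise D S lam g (N + j) ω‖ ^ 2 := by
      funext i ω
      rw [← congrFun (hdiff N i) ω]
    rw [hfun]
    refine submartingale_nat (fun i => (hmeas N i).norm.pow 2) (hint N) fun i => ?_
    filter_upwards [hcond N i] with ω hω
    refine le_of_le_of_eq ?_ hω.symm
    exact le_add_of_nonneg_right (mul_nonneg (sq_nonneg _) (operatorVariance_nonneg _))
  · have hfun : (fun ω => ‖∑ j ∈ Finset.range (N + i), skmNoise D S lam g j ω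
        - ∑ j ∈ Finset.range N, skmNoise D S lam g j ω‖ ^ 2) =
        fun ω => ‖∑ j ∈ Finset.range i, skmNoise D S lam g (N + j) ω‖ ^ 2 := by
      funext ω
      rw [← congrFun (hdiff N i) ω]
    rw [hfun]
    have hC0 : 0 ≤ 2 * C + 2 * σ := by
      have : 0 ≤ C := (integral_nonneg fun ω => by positivity).trans (hC 0)
      have : 0 ≤ σ := operatorVariance_nonneg p
      positivity
    have hle : ∫ ω, ‖∑ j ∈ Finset.range i, skmNoise D S lam g (N + j) ω‖ ^ 2 ∂P
        ≤ (2 * C + 2 * σ) * ∑ j ∈ Finset.range i, lam (j + N) ^ 2 := by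
      induction i with
      | zero => simp
      | succ i ih =>
        have hb : Integrable (fun ω => lam (N + i) ^ 2 * (2 * ‖g (N + i) ω - p‖ ^ 2 + 2 * σ)) P :=
          (((hsq _).const_mul 2).add (integrable_const _)).const_mul _
        calc ∫ ω, ‖∑ j ∈ Finset.range (i + 1), skmNoise D S lam g (N + j) ω‖ ^ 2 ∂P
            = ∫ ω, (P[fun ω => ‖∑ j ∈ Finset.range (i + 1), skmNoise D S lam g (N + j) ω‖ ^ 2
                | ℱ (N + i)]) ω ∂P := (integral_condExp (ℱ.le _)).symm
          _ ≤ ∫ ω, (‖∑ j ∈ Finset.range i, skmNoise D S lam g (N + j) ω‖ ^ 2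
                + lam (N + i) ^ 2 * (2 * ‖g (N + i) ω - p‖ ^ 2 + 2 * σ)) ∂P := by
              refine integral_mono_ae integrable_condExp ((hint N i).add hb) ?_
              filter_upwards [hcond N i] with ω hω
              rw [hω]
              gcongr
              exact operatorVariance_le hS hS_int hp hfix _
          _ = ∫ ω, ‖∑ j ∈ Finset.range i, skmNoise D S lam g (N + j) ω‖ ^ 2 ∂P
                + lam (N + i) ^ 2 * (2 * ∫ ω, ‖g (N + i) ω - p‖ ^ 2 ∂P + 2 * σ) := by
              rw [integral_add (hint N i) hb, integral_const_mul,
                integral_add ((hsq _).const_mul 2) (integrable_const _), integral_const_mul]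
              simp
          _ ≤ (2 * C + 2 * σ) * ∑ j ∈ Finset.range i, lam (j + N) ^ 2
                + lam (N + i) ^ 2 * (2 * C + 2 * σ) := by
              refine add_le_add (ih (by
                funext ω; rw [← congrFun (hdiff N i) ω])) ?_
              gcongr
              exact hC _
          _ = _ := by rw [Finset.sum_range_succ, add_comm i N]; ring
    refine hle.trans (mul_le_mul_of_nonneg_left ?_ hC0)
    exact ((summable_nat_add_iff N).2 hlam_sq).sum_le_tsum _ fun j _ => sq_nonneg _
  · simpa using (tendsto_sum_nat_add fun j => lam j ^ 2).const_mul (2 * C + 2 * σ)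

/-- Almost sure weak convergence of an adapted stochastic Krasnoselskii–Mann process. -/
theorem ae_tendsto [CompleteSpace H] (h : IsSKMProcess D S lam P ℱ X g)
    (hS : ∀ᵐ ξ ∂D, ∀ x y : H, ‖S ξ x - S ξ y‖ ≤ ‖x - y‖)
    (hS_int : ∀ x : H, Integrable (fun ξ => S ξ x) D) (hp : MemLp (fun ξ => S ξ p) 2 D)
    (hfix : expectedOperator D S p = p) (hlam : ∀ k, 0 < lam k)
    (hlam_sq : Summable (fun k => lam k ^ 2)) (hlam_one : ¬ Summable lam) :
    ∀ᵐ ω ∂P, Tendsto (fun k => ‖expectedOperator D S (g k ω) - g k ω‖) atTop (𝓝 0) ∧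
      ∃ q ∈ Function.fixedPoints (expectedOperator D S),
        Tendsto (fun k => toWeakSpace ℝ H (g k ω)) atTop (𝓝 (toWeakSpace ℝ H q)) := by
  have hT := norm_expectedOperator_sub_le hS hS_int
  have hlam0 : Tendsto lam atTop (𝓝 0) := by
    have := (Real.continuous_sqrt.tendsto _).comp hlam_sq.tendsto_atTop_zero
    rw [Real.sqrt_zero] at this
    exact this.congr fun k => Real.sqrt_sq (hlam k).le
  -- The separable subspace containing all iterates, on which countably many fixed points suffice.
  set V : Submodule ℝ H :=
    (Submodule.span ℝ (⋃ k, Set.range (g k))).topologicalClosure with hVdef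
  have hVsep : TopologicalSpace.IsSeparable (V : Set H) := by
    refine (TopologicalSpace.IsSeparable.span ?_).closure
    exact TopologicalSpace.IsSeparable.iUnion fun k =>
      ((h.adapted k).mono (ℱ.le k)).isSeparable_range
  have hgV : ∀ k ω, g k ω ∈ V := fun k ω => Submodule.le_topologicalClosure _
    (Submodule.subset_span (Set.mem_iUnion.2 ⟨k, ω, rfl⟩))
  obtain ⟨Q, hQsub, hQc, hQd⟩ := (hVsep.mono (u := {q | q ∈ V ∧ expectedOperator D S q = q})
    fun q hq => hq.1).exists_countable_dense_subset
  have hQae : ∀ᵐ ω ∂P, ∀ q ∈ Q, ∃ c, Tendsto (fun k => ‖g k ω - q‖) atTop (𝓝 c) := by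
    rw [ae_ball_iff hQc]
    intro q hq
    filter_upwards [(h.ae_tendsto_and_summable hS hS_int
      (memLp_two_of_nonexpansive hS hS_int hp q) (hQsub hq).2 (fun k => (hlam k).le) hlam_sq).1]
      with ω hω using hω.1
  filter_upwards [hQae,
    (h.ae_tendsto_and_summable hS hS_int hp hfix (fun k => (hlam k).le) hlam_sq).1,
    h.ae_cauchySeq_sum_noise hS hS_int hp hfix (fun k => (hlam k).le) hlam_sq]
    with ω hQω ⟨⟨c, hc⟩, hsum⟩ hM
  have hr : Tendsto (fun k => ‖expectedOperator D S (g k ω) - g k ω‖) atTop (𝓝 0) := by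
    refine tendsto_zero_of_summable_mul_sq hlam hlam0 hlam_one (fun k => norm_nonneg _) hsum hM ?_
    intro m n hmn
    have e1 : g n ω - g m ω = ∑ k ∈ Finset.Ico m n,
        lam k • (expectedOperator D S (g k ω) - g k ω)
        + (∑ j ∈ Finset.range n, skmNoise D S lam g j ω
          - ∑ j ∈ Finset.range m, skmNoise D S lam g j ω) := by
      rw [← Finset.sum_Ico_eq_sub _ hmn, ← Finset.sum_add_distrib,
        ← Finset.sum_Ico_sub (fun k => g k ω) hmn]
      refine Finset.sum_congr rfl fun k _ => ?_
      rw [skmNoise]; abel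
    have e2 : ‖g n ω - g m ω‖ ≤
        ∑ k ∈ Finset.Ico m n, lam k * ‖expectedOperator D S (g k ω) - g k ω‖
        + ‖∑ j ∈ Finset.range n, skmNoise D S lam g j ω
          - ∑ j ∈ Finset.range m, skmNoise D S lam g j ω‖ := by
      rw [e1]
      refine (norm_add_le _ _).trans (add_le_add_left ?_ _)
      refine (norm_sum_le _ _).trans_eq (Finset.sum_congr rfl fun k _ => ?_)
      rw [norm_smul, Real.norm_of_nonneg (hlam k).le]
    -- `T - id` is 2-Lipschitz, whence the factors 2 in the residual criterion.
    have e3 : |‖expectedOperator D S (g n ω) - g n ω‖ - ‖expectedOperator D S (g m ω) - g m ω‖|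
        ≤ ‖g n ω - g m ω‖ + ‖g n ω - g m ω‖ := by
      refine (abs_norm_sub_norm_le _ _).trans ?_
      rw [sub_sub_sub_comm]
      exact (norm_sub_le _ _).trans (add_le_add_left (hT _ _) _)
    linarith
  refine ⟨hr, ?_⟩
  obtain ⟨B, hB⟩ := hc.bddAbove_range
  refine exists_fixedPt_tendsto_toWeakSpace hT (B := B + ‖p‖) (fun k => ?_) hr
    (Submodule.isClosed_topologicalClosure _) (fun k => hgV k ω) fun q hqV hq => ?_
  · calc ‖g k ω‖ = ‖g k ω - p + p‖ := by rw [sub_add_cancel]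
      _ ≤ _ := (norm_add_le _ _).trans (add_le_add_left (hB ⟨k, rfl⟩) _)
  -- Distances to `q` and to a nearby `q' ∈ Q` differ by at most `dist q q'` uniformly in `k`, so
  -- the Cauchy property passes from `Q` to its closure.
  · refine cauchySeq_tendsto_of_complete (Metric.cauchySeq_iff.2 fun ε hε => ?_)
    obtain ⟨q', hq'Q, hqq'⟩ := Metric.mem_closure_iff.1 (hQd ⟨hqV, hq⟩) (ε / 3) (by positivity)
    obtain ⟨c', hc'⟩ := hQω q' hq'Q
    obtain ⟨N, hN⟩ := Metric.cauchySeq_iff.1 hc'.cauchySeq (ε / 3) (by positivity)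
    have hclose : ∀ k, |‖g k ω - q‖ - ‖g k ω - q'‖| ≤ dist q q' := fun k => by
      refine (abs_norm_sub_norm_le _ _).trans_eq ?_
      rw [sub_sub_sub_cancel_left, ← dist_eq_norm, dist_comm]
    refine ⟨N, fun m hm n hn => ?_⟩
    have h1 := hN m hm n hn
    have h2 := abs_le.1 (hclose m)
    have h3 := abs_le.1 (hclose n)
    rw [Real.dist_eq, abs_lt] at h1 ⊢
    constructor <;> linarith [h1.1, h1.2, h2.1, h2.2, h3.1, h3.2]

end IsSKMProcess

end Iteration

/-! ### Adapted versions of the iterates driven by independent samples. -/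

section Samples

variable {Ω Ξ : Type*} [mΩ : MeasurableSpace Ω] [mΞ : MeasurableSpace Ξ]

/-- The filtration of the strict past of a sequence of random variables. -/
def strictPast {ξ : ℕ → Ω → Ξ} (hξ : ∀ k, Measurable (ξ k)) : Filtration ℕ mΩ where
  seq k := ⨆ j ∈ Set.Iio k, mΞ.comap (ξ j)
  mono' _ _ hab := biSup_mono fun _ hj => lt_of_lt_of_le hj hab
  le' _ := iSup₂_le fun j _ => (hξ j).comap_le

theorem indep_strictPast {P : Measure Ω} {ξ : ℕ → Ω → Ξ} (hξ : ∀ k, Measurable (ξ k))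
    (hind : iIndepFun ξ P) (k : ℕ) : Indep (strictPast hξ k) (mΞ.comap (ξ k)) P := by
  have := indep_iSup_of_disjoint (fun j => (hξ j).comap_le) hind
    (S := Set.Iio k) (T := {k}) (by simp)
  rwa [iSup_singleton] at this

theorem measurable_strictPast_succ {ξ : ℕ → Ω → Ξ} (hξ : ∀ k, Measurable (ξ k)) (k : ℕ) :
    Measurable[strictPast hξ (k + 1)] (ξ k) :=
  measurable_iff_comap_le.2 (le_iSup₂_of_le (f := fun j (_ : j ∈ Set.Iio (k + 1)) =>
    mΞ.comap (ξ j)) k (Nat.lt_succ_self k) le_rfl)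

/-- `S ξ` is nonexpansive only for almost every `ξ`, so the iterates are shown to be measurable only
up to null sets. Strongly measurable representatives give true adaptedness, at the price of a
recursion valid almost surely. -/
theorem exists_isSKMProcess {H : Type*} [NormedAddCommGroup H] [InnerProductSpace ℝ H]
    {D : Measure Ξ} [IsProbabilityMeasure D] {S : Ξ → H → H}
    (hS : ∀ᵐ ξ ∂D, ∀ x y : H, ‖S ξ x - S ξ y‖ ≤ ‖x - y‖)
    (hS_int : ∀ x : H, Integrable (fun ξ => S ξ x) D) (lam : ℕ → ℝ)
    {P : Measure Ω} [IsProbabilityMeasure P] {ξ : ℕ → Ω → Ξ} (hξ : ∀ k, Measurable (ξ k))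
    (hind : iIndepFun ξ P) (hlaw : ∀ k, P.map (ξ k) = D) (x₀ : H) :
    ∃ g : ℕ → Ω → H, IsSKMProcess D S lam P (strictPast hξ) ξ g ∧
      ∀ᵐ ω ∂P, ∀ k, skmIterate S lam x₀ (fun j => ξ j ω) k = g k ω := by
  have hx : ∀ k, AEStronglyMeasurable[strictPast hξ k]
      (fun ω => skmIterate S lam x₀ (fun j => ξ j ω) k) P := by
    intro k
    induction k with
    | zero => exact stronglyMeasurable_const.aestronglyMeasurable
    | succ k ih =>
      obtain ⟨f, hf, hfe⟩ := ih
      have hSf := aestronglyMeasurable_apply_of_indep hS hS_int ((strictPast hξ).le k) (hξ k)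
        (indep_strictPast hξ hind k) (hlaw k) hf ((strictPast hξ).mono k.le_succ)
        (measurable_strictPast_succ hξ k)
      have hf' : AEStronglyMeasurable[strictPast hξ (k + 1)] f P :=
        ⟨f, hf.mono ((strictPast hξ).mono k.le_succ), ae_eq_rfl⟩
      refine ((hf'.const_smul (1 - lam k)).add (hSf.const_smul (lam k))).congr ?_
      filter_upwards [hfe] with ω hω
      simp [skmIterate, hω]
  choose g hg hge using hx
  refine ⟨g, ⟨hξ, indep_strictPast hξ hind, hlaw, hg, ?_, fun k => ?_⟩, ae_all_iff.2 hge⟩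
  · exact (memLp_const x₀).ae_eq (hge 0)
  · filter_upwards [hge k, hge (k + 1)] with ω h1 h2
    rw [← h1, ← h2, skmIterate]

end Samples

theorem theorem2p2
    {H : Type*} [NormedAddCommGroup H] [InnerProductSpace ℝ H] [CompleteSpace H]
    -- the oracle: operators `S ξ = T_ξ`, with `ξ` distributed according to `D`
    {Ξ : Type*} [MeasurableSpace Ξ] (D : Measure Ξ) [IsProbabilityMeasure D]
    (S : Ξ → H → H)
    (hS_nonexp : ∀ᵐ ξ ∂D, ∀ x y : H, ‖S ξ x - S ξ y‖ ≤ ‖x - y‖)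
    -- measurability in `ξ`, and existence of the expectation defining `T`
    (hS_int : ∀ x : H, Integrable (fun ξ => S ξ x) D)
    -- `Fix T` is nonempty, and the variance is finite at some fixed point
    (hFix : (Function.fixedPoints (expectedOperator D S)).Nonempty)
    (hVar : ∃ p ∈ Function.fixedPoints (expectedOperator D S),
      ∫⁻ ξ, ‖S ξ p - expectedOperator D S p‖ₑ ^ 2 ∂D < ⊤)
    -- the relaxation parameters
    (lam : ℕ → ℝ) (hlam : ∀ k, lam k ∈ Set.Ioo (0 : ℝ) 1)
    (hlam_sq : Summable (fun k => lam k ^ 2)) (hlam_one : ¬ Summable lam)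
    -- the independent samples `ξ k ∼ D`, on a probability space `(Ω, P)`
    {Ω : Type*} [MeasurableSpace Ω] (P : Measure Ω) [IsProbabilityMeasure P]
    (ξ : ℕ → Ω → Ξ) (hξ_meas : ∀ k, Measurable (ξ k))
    (hξ_indep : iIndepFun ξ P) (hξ_law : ∀ k, P.map (ξ k) = D)
    -- the starting point
    (x₀ : H) :
    ∀ᵐ ω ∂P,
      Tendsto
        (fun k => ‖expectedOperator D S (skmIterate S lam x₀ (fun j => ξ j ω) k)
          - skmIterate S lam x₀ (fun j => ξ j ω) k‖) atTop (𝓝 0) ∧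
      ∃ p ∈ Function.fixedPoints (expectedOperator D S),
        Tendsto (fun k => toWeakSpace ℝ H (skmIterate S lam x₀ (fun j => ξ j ω) k))
          atTop (𝓝 (toWeakSpace ℝ H p)) := by
  obtain ⟨p, hfix, hp⟩ := hVar
  have hp2 := memLp_two_of_lintegral_lt_top hS_int hp
  obtain ⟨g, hg, hge⟩ := exists_isSKMProcess hS_nonexp hS_int lam hξ_meas hξ_indep hξ_law x₀
  filter_upwards [hge, hg.ae_tendsto hS_nonexp hS_int hp2 hfix (fun k => (hlam k).1) hlam_sq
    hlam_one] with ω h1 h2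
  simpa only [h1] using h2
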